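/- Let $X$ be a real normed linear space. For $x,y\in X$ put $$\rho'_{\pm}(x,y)=\|x\|\lim_{t\to 0^{\pm}}\frac{\|x+ty\|-\|x\|}{t},\qquad \rho'(x,y)=\tfrac12\bigl(\rho'_+(x,y)+\rho'_-(x,y)\bigr)$$ (these limits always exist), and write $x\perp_\rho y$ if $\rho'(x,y)=0$. The space $X$ is called $\rho$-symmetric if $x\perp_\rho y$ implies $y\perp_\rho x$ for all $x,y\in X$. Write $x\perp_B y$ (Birkhoff–James orthogonality) if $\|x+\lambda y\|\ge\|x\|$ for all $\lambda\in\mathbb{R}$. A Radon plane is a two-dimensional real normed space in which $x\perp_B y$ implies $y\perp_B x$ for all $x,y$. (i) If $\dim X=2$ and $X$ is $\rho$-symmetric, then $X$ is a Radon plane. (ii) If $\dim X\ge 3$ (possibly infinite), then $X$ is $\rho$-symmetric if and only if the norm of $X$ is induced by an inner product on $X$. -/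

import Mathlib

namespace NormDeriv

open Filter Topology Set

variable {X : Type*} [NormedAddCommGroup X] [NormedSpace ℝ X]

/-- The upper norm derivative `ρ'₊(x, y) = ‖x‖ · lim_{t → 0⁺} (‖x + t y‖ - ‖x‖) / t`.
The limit always exists, see `tendsto_rhoPlus`. -/
noncomputable def rhoPlus (x y : X) : ℝ :=
  ‖x‖ * limUnder (𝓝[>] (0 : ℝ)) (fun t : ℝ => (‖x + t • y‖ - ‖x‖) / t)

/-- The lower norm derivative `ρ'₋(x, y) = ‖x‖ · lim_{t → 0⁻} (‖x + t y‖ - ‖x‖) / t`.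
The limit always exists, see `tendsto_rhoMinus`. -/
noncomputable def rhoMinus (x y : X) : ℝ :=
  ‖x‖ * limUnder (𝓝[<] (0 : ℝ)) (fun t : ℝ => (‖x + t • y‖ - ‖x‖) / t)

/-- The norm derivative `ρ'(x, y) = (ρ'₊(x, y) + ρ'₋(x, y)) / 2`. -/
noncomputable def rho (x y : X) : ℝ := (rhoPlus x y + rhoMinus x y) / 2

/-- `ρ`-orthogonality: `x ⊥_ρ y` means `ρ'(x, y) = 0`. -/
def RhoOrth (x y : X) : Prop := rho x y = 0

/-- Birkhoff–James orthogonality: `x ⊥_B y` means `‖x + c y‖ ≥ ‖x‖` for all real `c`. -/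
def BJOrth (x y : X) : Prop := ∀ c : ℝ, ‖x‖ ≤ ‖x + c • y‖

variable (X) in
/-- The space is `ρ`-symmetric: `x ⊥_ρ y` implies `y ⊥_ρ x`. -/
def IsRhoSymmetric : Prop := ∀ x y : X, RhoOrth x y → RhoOrth y x

variable (X) in
/-- A Radon plane: a two-dimensional real normed space (automatically complete)
in which Birkhoff–James orthogonality is symmetric. -/
def IsRadonPlane : Prop :=
  Module.rank ℝ X = 2 ∧ ∀ x y : X, BJOrth x y → BJOrth y x

variable (X) in
/-- The norm of `X` is induced by an inner product on the real vector space `X`. -/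
def NormFromInner : Prop :=
  ∃ c : InnerProductSpace.Core ℝ X, ∀ x : X, ‖x‖ = √(c.inner x x)

theorem convexOn_norm_line (x y : X) : ConvexOn ℝ univ (fun t : ℝ => ‖x + t • y‖) := by
  refine ⟨convex_univ, fun s _ t _ a b ha hb hab => ?_⟩
  have h : x + (a • s + b • t) • y = a • (x + s • y) + b • (x + t • y) := by
    have : x = (a + b) • x := by rw [hab, one_smul]
    nth_rewrite 1 [this]
    simp only [smul_eq_mul]
    module
  change ‖x + (a • s + b • t) • y‖ ≤ a * ‖x + s • y‖ + b * ‖x + t • y‖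
  rw [h]
  refine (norm_add_le _ _).trans ?_
  rw [norm_smul, norm_smul, Real.norm_of_nonneg ha, Real.norm_of_nonneg hb]

theorem quotient_eq_slope (x y : X) :
    (fun t : ℝ => (‖x + t • y‖ - ‖x‖) / t) = slope (fun t : ℝ => ‖x + t • y‖) 0 := by
  funext t
  simp [slope_def_field]

/-- The limit in the definition of `rhoPlus` exists. -/
theorem tendsto_rhoPlus (x y : X) :
    Tendsto (fun t : ℝ => (‖x + t • y‖ - ‖x‖) / t) (𝓝[>] (0 : ℝ))
      (𝓝 (limUnder (𝓝[>] (0 : ℝ)) (fun t : ℝ => (‖x + t • y‖ - ‖x‖) / t))) := by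
  apply tendsto_nhds_limUnder
  have h := ((convexOn_norm_line x y).differentiableWithinAt_Ioi_of_mem_interior
    (x := 0) (by simp)).hasDerivWithinAt
  rw [hasDerivWithinAt_iff_tendsto_slope' (by simp)] at h
  rw [quotient_eq_slope]
  exact ⟨_, h⟩

/-- The limit in the definition of `rhoMinus` exists. -/
theorem tendsto_rhoMinus (x y : X) :
    Tendsto (fun t : ℝ => (‖x + t • y‖ - ‖x‖) / t) (𝓝[<] (0 : ℝ))
      (𝓝 (limUnder (𝓝[<] (0 : ℝ)) (fun t : ℝ => (‖x + t • y‖ - ‖x‖) / t))) := by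
  apply tendsto_nhds_limUnder
  have h := ((convexOn_norm_line x y).differentiableWithinAt_Iio_of_mem_interior
    (x := 0) (by simp)).hasDerivWithinAt
  rw [hasDerivWithinAt_iff_tendsto_slope' (by simp)] at h
  rw [quotient_eq_slope]
  exact ⟨_, h⟩

end NormDeriv

namespace NormDeriv

open Filter Topology Set

/-! ### Norm derivatives and Birkhoff–James orthogonality in an arbitrary normed space. -/

section General

variable {X : Type*} [NormedAddCommGroup X] [NormedSpace ℝ X]

/-! ρ-orthogonality always implies Birkhoff–James orthogonality. Under ρ-symmetry the converse holds
(`IsRhoSymmetric.rhoOrth_of_bjOrth`), so the two relations agree. This gives (i), and it makes the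
norm smooth, so that each `rho x` is a linear functional.

In dimension at least three, symmetry carries linearity over to the first slot: for fixed `u`, the
`w` with `rho w u = 0` form a subspace. For mutually orthogonal nonzero `x`, `y`, `z` this makes
slopes multiplicative (`IsRhoSymmetric.rhoSlope_mul`). Together with monotonicity and an involution
coming from symmetry, `eq_mul_of_involutive` forces `rhoSlope x y p` to be linear in `p > 0`.
Integrating along a line yields Pythagoras for orthogonal vectors, hence the parallelogram law and,
by Jordan–von Neumann, an inner product. Conversely, for an inner product norm `rho` is the inner
product. -/

theorem tendsto_mul_quotient_rhoPlus (x y : X) :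
    Tendsto (fun t : ℝ => ‖x‖ * ((‖x + t • y‖ - ‖x‖) / t)) (𝓝[>] (0 : ℝ)) (𝓝 (rhoPlus x y)) :=
  (tendsto_rhoPlus x y).const_mul _

theorem tendsto_mul_quotient_rhoMinus (x y : X) :
    Tendsto (fun t : ℝ => ‖x‖ * ((‖x + t • y‖ - ‖x‖) / t)) (𝓝[<] (0 : ℝ)) (𝓝 (rhoMinus x y)) :=
  (tendsto_rhoMinus x y).const_mul _

theorem rhoPlus_eq_of_hasDerivAt {x y : X} {d : ℝ}
    (h : HasDerivAt (fun t : ℝ => ‖x + t • y‖) d 0) : rhoPlus x y = ‖x‖ * d := by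
  have h1 := tendsto_rhoPlus x y
  rw [hasDerivAt_iff_tendsto_slope, ← quotient_eq_slope] at h
  have h2 := h.mono_left (nhdsWithin_mono (0 : ℝ) (fun t (ht : t ∈ Ioi 0) => ne_of_gt ht))
  rw [rhoPlus, tendsto_nhds_unique h1 h2]

theorem rhoMinus_eq_of_hasDerivAt {x y : X} {d : ℝ}
    (h : HasDerivAt (fun t : ℝ => ‖x + t • y‖) d 0) : rhoMinus x y = ‖x‖ * d := by
  have h1 := tendsto_rhoMinus x y
  rw [hasDerivAt_iff_tendsto_slope, ← quotient_eq_slope] at h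
  have h2 := h.mono_left (nhdsWithin_mono (0 : ℝ) (fun t (ht : t ∈ Iio 0) => ne_of_lt ht))
  rw [rhoMinus, tendsto_nhds_unique h1 h2]

theorem rho_eq_of_hasDerivAt {x y : X} {d : ℝ}
    (h : HasDerivAt (fun t : ℝ => ‖x + t • y‖) d 0) : rho x y = ‖x‖ * d := by
  rw [rho, rhoPlus_eq_of_hasDerivAt h, rhoMinus_eq_of_hasDerivAt h]
  ring

@[simp] theorem rhoPlus_zero_left (y : X) : rhoPlus 0 y = 0 := by simp [rhoPlus]

@[simp] theorem rhoMinus_zero_left (y : X) : rhoMinus 0 y = 0 := by simp [rhoMinus]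

@[simp] theorem rho_zero_left (y : X) : rho 0 y = 0 := by simp [rho]

theorem rhoMinus_eq_neg_rhoPlus_neg (x y : X) : rhoMinus x y = -rhoPlus x (-y) := by
  have h1 : Tendsto (fun t : ℝ => -t) (𝓝[<] (0 : ℝ)) (𝓝[>] (0 : ℝ)) := by
    simpa using tendsto_neg_nhdsLT (a := (0 : ℝ))
  have h2 := ((tendsto_mul_quotient_rhoPlus x (-y)).comp h1).neg
  refine tendsto_nhds_unique (tendsto_mul_quotient_rhoMinus x y) (h2.congr fun t => ?_)
  simp [div_neg]

theorem tendsto_mul_nhdsGT_zero {s : ℝ} (hs : 0 < s) :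
    Tendsto (fun t : ℝ => s * t) (𝓝[>] (0 : ℝ)) (𝓝[>] (0 : ℝ)) := by
  refine tendsto_nhdsWithin_iff.2 ⟨?_, ?_⟩
  · have : Tendsto (fun t : ℝ => s * t) (𝓝 (0 : ℝ)) (𝓝 (s * 0)) :=
      (continuous_const.mul continuous_id).tendsto _
    rw [mul_zero] at this
    exact this.mono_left nhdsWithin_le_nhds
  · filter_upwards [self_mem_nhdsWithin] with t ht
    exact mul_pos hs ht

theorem rhoPlus_smul_right (x y : X) {s : ℝ} (hs : 0 < s) :
    rhoPlus x (s • y) = s * rhoPlus x y := by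
  have h := ((tendsto_mul_quotient_rhoPlus x y).comp (tendsto_mul_nhdsGT_zero hs)).const_mul s
  refine tendsto_nhds_unique (tendsto_mul_quotient_rhoPlus x (s • y)) (h.congr fun t => ?_)
  have : t • s • y = (s * t) • y := by module
  rw [Function.comp_apply, this, ← div_div, div_right_comm]
  field_simp

theorem rhoPlus_add_le (x y z : X) : rhoPlus x (y + z) ≤ rhoPlus x y + rhoPlus x z := by
  have h2 := tendsto_mul_nhdsGT_zero (s := 2) two_pos
  have h := ((tendsto_mul_quotient_rhoPlus x y).comp h2).add
    ((tendsto_mul_quotient_rhoPlus x z).comp h2)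
  refine le_of_tendsto_of_tendsto (tendsto_mul_quotient_rhoPlus x (y + z)) h ?_
  filter_upwards [self_mem_nhdsWithin] with t (ht : 0 < t)
  simp only [Function.comp_apply]
  rw [← mul_add, ← add_div]
  refine mul_le_mul_of_nonneg_left ?_ (norm_nonneg x)
  rw [div_le_div_iff₀ ht (by positivity)]
  -- Midpoint convexity; this is why the two limits were reparametrized by `2 * t`.
  have e : (2 : ℝ) • (x + t • (y + z)) = (x + (2 * t) • y) + (x + (2 * t) • z) := by module
  have h3 := norm_add_le (x + (2 * t) • y) (x + (2 * t) • z)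
  rw [← e, norm_smul, Real.norm_two] at h3
  nlinarith

theorem rhoPlus_smul_self (x : X) (a : ℝ) : rhoPlus x (a • x) = a * ‖x‖ ^ 2 := by
  have h : Tendsto (fun _ : ℝ => a * ‖x‖ ^ 2) (𝓝[>] (0 : ℝ)) (𝓝 (a * ‖x‖ ^ 2)) :=
    tendsto_const_nhds
  refine tendsto_nhds_unique (tendsto_mul_quotient_rhoPlus x (a • x)) (h.congr' ?_)
  have hc : ∀ᶠ t : ℝ in 𝓝[>] (0 : ℝ), 0 < 1 + t * a := by
    have : Tendsto (fun t : ℝ => 1 + t * a) (𝓝 0) (𝓝 (1 + 0 * a)) :=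
      (continuous_const.add (continuous_id.mul continuous_const)).tendsto _
    exact (this.mono_left nhdsWithin_le_nhds).eventually (lt_mem_nhds (by simp))
  filter_upwards [self_mem_nhdsWithin, hc] with t (ht : 0 < t) h1
  have e : x + t • a • x = (1 + t * a) • x := by module
  rw [e, norm_smul, Real.norm_of_nonneg h1.le]
  field_simp
  ring

theorem rhoPlus_add_smul_self (x y : X) (a : ℝ) :
    rhoPlus x (y + a • x) = rhoPlus x y + a * ‖x‖ ^ 2 := by
  have h1 := rhoPlus_add_le x y (a • x)
  have h2 := rhoPlus_add_le x (y + a • x) ((-a) • x)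
  rw [rhoPlus_smul_self] at h1 h2
  have e : y + a • x + (-a) • x = y := by module
  rw [e] at h2
  linarith

theorem rhoMinus_add_smul_self (x y : X) (a : ℝ) :
    rhoMinus x (y + a • x) = rhoMinus x y + a * ‖x‖ ^ 2 := by
  have e : -(y + a • x) = -y + (-a) • x := by module
  rw [rhoMinus_eq_neg_rhoPlus_neg, rhoMinus_eq_neg_rhoPlus_neg, e, rhoPlus_add_smul_self]
  ring

theorem rho_add_smul_self (x y : X) (a : ℝ) : rho x (y + a • x) = rho x y + a * ‖x‖ ^ 2 := by
  rw [rho, rho, rhoPlus_add_smul_self, rhoMinus_add_smul_self]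
  ring

theorem rhoPlus_le (x y : X) : rhoPlus x y ≤ ‖x‖ * ‖y‖ := by
  refine le_of_tendsto (tendsto_mul_quotient_rhoPlus x y) ?_
  filter_upwards [self_mem_nhdsWithin] with t (ht : 0 < t)
  refine mul_le_mul_of_nonneg_left ?_ (norm_nonneg x)
  rw [div_le_iff₀ ht]
  have := norm_add_le x (t • y)
  rw [norm_smul, Real.norm_of_nonneg ht.le] at this
  linarith

theorem rhoMinus_le_rhoPlus (x y : X) : rhoMinus x y ≤ rhoPlus x y := by
  have h := rhoPlus_add_le x y (-y)
  have h0 : rhoPlus x (y + -y) = 0 := by simpa using rhoPlus_smul_self x 0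
  rw [rhoMinus_eq_neg_rhoPlus_neg]
  linarith

theorem rho_neg_right (x y : X) : rho x (-y) = -rho x y := by
  simp only [rho, rhoMinus_eq_neg_rhoPlus_neg, neg_neg]
  ring

/-- The subgradient inequality for `rhoPlus`. -/
theorem norm_sq_add_rhoPlus_le (x y : X) : ‖x‖ ^ 2 + rhoPlus x y ≤ ‖x‖ * ‖x + y‖ := by
  have h := rhoPlus_add_smul_self x y 1
  have h' := rhoPlus_le x (y + (1 : ℝ) • x)
  rw [one_smul] at h h'
  rw [add_comm x y]
  linarith

theorem bjOrth_iff (x y : X) : BJOrth x y ↔ rhoMinus x y ≤ 0 ∧ 0 ≤ rhoPlus x y := by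
  have key : ∀ u : X, BJOrth x u → 0 ≤ rhoPlus x u := by
    intro u hu
    refine ge_of_tendsto (tendsto_mul_quotient_rhoPlus x u) ?_
    filter_upwards [self_mem_nhdsWithin] with t (ht : 0 < t)
    exact mul_nonneg (norm_nonneg x) (div_nonneg (sub_nonneg.2 (hu t)) ht.le)
  constructor
  · intro h
    refine ⟨?_, key y h⟩
    rw [rhoMinus_eq_neg_rhoPlus_neg, neg_nonpos]
    exact key _ fun c => by simpa using h (-c)
  · rintro ⟨h1, h2⟩ c
    rw [rhoMinus_eq_neg_rhoPlus_neg, neg_nonpos] at h1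
    have hc : 0 ≤ rhoPlus x (c • y) := by
      rcases lt_trichotomy c 0 with hc | rfl | hc
      · have e : c • y = (-c) • (-y) := by module
        rw [e, rhoPlus_smul_right _ _ (by linarith)]
        exact mul_nonneg (by linarith) h1
      · simpa using (rhoPlus_smul_self x 0).ge
      · rw [rhoPlus_smul_right _ _ hc]
        exact mul_nonneg hc.le h2
    rcases (norm_nonneg x).eq_or_lt with h0 | h0
    · rw [← h0]; exact norm_nonneg _
    · have := norm_sq_add_rhoPlus_le x (c • y)
      refine le_of_mul_le_mul_left ?_ h0
      nlinarith

theorem RhoOrth.bjOrth {x y : X} (h : RhoOrth x y) : BJOrth x y := by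
  have h1 := rhoMinus_le_rhoPlus x y
  rw [RhoOrth, rho] at h
  exact (bjOrth_iff x y).2 ⟨by linarith, by linarith⟩

/-- On the relative interior of a segment on which the norm is constant, the direction of the
segment is `ρ`-orthogonal. -/
theorem rhoOrth_of_norm_eq {x y : X} {t : ℝ} (ht0 : 0 < t) (ht1 : t < 1)
    (h : ∀ s ∈ Icc (0 : ℝ) 1, ‖x + s • y‖ = ‖x‖) : RhoOrth (x + t • y) y := by
  have hd : HasDerivAt (fun s : ℝ => ‖x + t • y + s • y‖) 0 0 := by
    refine (hasDerivAt_const (0 : ℝ) ‖x‖).congr_of_eventuallyEq ?_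
    filter_upwards [Icc_mem_nhds (show -t < 0 by linarith) (show 0 < 1 - t by linarith)] with s hs
    have e : x + t • y + s • y = x + (t + s) • y := by module
    rw [e, h _ ⟨by linarith [hs.1], by linarith [hs.2]⟩]
  rw [RhoOrth, rho_eq_of_hasDerivAt hd, mul_zero]

/-- The norm is constant on a segment both of whose endpoints minimize it along the whole line. -/
theorem BJOrth.norm_segment_eq {x y : X} (h0 : BJOrth x y) (h1 : BJOrth (x + y) y) :
    ∀ s ∈ Icc (0 : ℝ) 1, ‖x + s • y‖ = ‖x‖ := by
  intro s hs
  have e1 : ‖x + y‖ = ‖x‖ := by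
    apply le_antisymm
    · simpa using h1 (-1)
    · simpa using h0 1
  refine le_antisymm ?_ (h0 s)
  have e : x + s • y = (1 - s) • x + s • (x + y) := by module
  rw [e]
  refine (norm_add_le _ _).trans ?_
  rw [norm_smul, norm_smul, Real.norm_of_nonneg hs.1, Real.norm_of_nonneg (by linarith [hs.2]), e1]
  linarith

end General

/-! ### Consequences of ρ-symmetry: equality of the orthogonalities, smoothness, linearity. -/

section Symmetric

variable {X : Type*} [NormedAddCommGroup X] [NormedSpace ℝ X]

theorem IsRhoSymmetric.rhoOrth_of_bjOrth (hX : IsRhoSymmetric X) {x y : X} (h : BJOrth x y) :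
    RhoOrth x y := by
  rcases eq_or_ne y 0 with rfl | hy
  · refine (rho_eq_of_hasDerivAt (d := 0) ?_).trans (mul_zero _)
    simpa using hasDerivAt_const (0 : ℝ) ‖x‖
  have hy2 : ‖y‖ ^ 2 ≠ 0 := pow_ne_zero 2 (norm_ne_zero_iff.2 hy)
  obtain ⟨a, ha⟩ : ∃ a : ℝ, rho y (x + a • y) = 0 :=
    ⟨-(rho y x / ‖y‖ ^ 2), by rw [rho_add_smul_self]; field_simp; ring⟩
  rcases eq_or_ne a 0 with rfl | ha0
  · rw [zero_smul, add_zero] at ha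
    exact hX _ _ ha
  exfalso
  have h0 : BJOrth x (a • y) := fun c => by simpa [smul_smul] using h (c * a)
  have h1 : BJOrth (x + a • y) (a • y) := fun c => by
    simpa [smul_smul] using (RhoOrth.bjOrth (hX _ _ ha)) (c * a)
  have hs := h0.norm_segment_eq h1
  -- The norm is constant on the segment from `x` to `x + a • y`, so symmetry applies at every
  -- interior point. The left side is affine in `t` with nonzero slope and cannot vanish twice.
  have key : ∀ t : ℝ, 0 < t → t < 1 → rho (a • y) x + t * ‖a • y‖ ^ 2 = 0 := fun t h h' => by
    rw [← rho_add_smul_self]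
    exact hX _ _ (rhoOrth_of_norm_eq h h' hs)
  have k1 := key (1 / 2) (by norm_num) (by norm_num)
  have k2 := key (1 / 3) (by norm_num) (by norm_num)
  have : ‖a • y‖ ^ 2 = 0 := by linarith
  simp [ha0, hy] at this

theorem IsRhoSymmetric.bjOrth_symm (hX : IsRhoSymmetric X) {x y : X} (h : BJOrth x y) :
    BJOrth y x :=
  RhoOrth.bjOrth (hX _ _ (hX.rhoOrth_of_bjOrth h))

/-- A `ρ`-symmetric space is smooth. -/
theorem IsRhoSymmetric.rho_eq_rhoPlus (hX : IsRhoSymmetric X) (x y : X) :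
    rho x y = rhoPlus x y := by
  rcases eq_or_ne x 0 with rfl | hx
  · simp
  have hx2 : ‖x‖ ^ 2 ≠ 0 := pow_ne_zero 2 (norm_ne_zero_iff.2 hx)
  -- Once `rhoPlus` vanishes, Birkhoff–James orthogonality holds and forces `rho` to vanish at the
  -- same vector.
  obtain ⟨a, ha⟩ : ∃ a : ℝ, rhoPlus x (y + a • x) = 0 :=
    ⟨-(rhoPlus x y / ‖x‖ ^ 2), by rw [rhoPlus_add_smul_self]; field_simp; ring⟩
  have h1 : BJOrth x (y + a • x) :=
    (bjOrth_iff _ _).2 ⟨(rhoMinus_le_rhoPlus _ _).trans ha.le, ha.ge⟩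
  have h2 : rho x (y + a • x) = 0 := hX.rhoOrth_of_bjOrth h1
  rw [rhoPlus_add_smul_self] at ha
  rw [rho_add_smul_self] at h2
  linarith

theorem IsRhoSymmetric.rho_add (hX : IsRhoSymmetric X) (x y z : X) :
    rho x (y + z) = rho x y + rho x z := by
  have h1 := rhoPlus_add_le x y z
  have h2 := rhoPlus_add_le x (-y) (-z)
  have e : -y + -z = -(y + z) := by abel
  rw [e] at h2
  simp only [← hX.rho_eq_rhoPlus, rho_neg_right] at h1 h2
  linarith

theorem IsRhoSymmetric.rho_smul (hX : IsRhoSymmetric X) (x y : X) (s : ℝ) :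
    rho x (s • y) = s * rho x y := by
  rcases lt_trichotomy s 0 with hs | rfl | hs
  · have e : s • y = -((-s) • y) := by module
    rw [e, rho_neg_right, hX.rho_eq_rhoPlus, rhoPlus_smul_right _ _ (by linarith),
      hX.rho_eq_rhoPlus]
    ring
  · rw [hX.rho_eq_rhoPlus]
    simpa using rhoPlus_smul_self x 0
  · rw [hX.rho_eq_rhoPlus, rhoPlus_smul_right _ _ hs, hX.rho_eq_rhoPlus]

theorem IsRhoSymmetric.rho_self (hX : IsRhoSymmetric X) (x : X) : rho x x = ‖x‖ ^ 2 := by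
  rw [hX.rho_eq_rhoPlus]
  simpa using rhoPlus_smul_self x 1

theorem IsRhoSymmetric.rho_le (hX : IsRhoSymmetric X) (x y : X) : rho x y ≤ ‖x‖ * ‖y‖ := by
  rw [hX.rho_eq_rhoPlus]
  exact rhoPlus_le x y

/-- In a `ρ`-symmetric space, `ρ(x, ·)` is a linear functional. -/
noncomputable def IsRhoSymmetric.rhoLin (hX : IsRhoSymmetric X) (x : X) : X →ₗ[ℝ] ℝ where
  toFun := rho x
  map_add' := hX.rho_add x
  map_smul' s y := hX.rho_smul x y s

/-! ### Slopes in orthogonal frames. -/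

/-- The slope of the functional `ρ(x + p y, ·)` in the plane spanned by `x` and `y`. -/
noncomputable def rhoSlope (x y : X) (p : ℝ) : ℝ := rho (x + p • y) y / rho (x + p • y) x

theorem IsRhoSymmetric.rho_left_pos (hX : IsRhoSymmetric X) {x y : X} (hx : x ≠ 0)
    (h : RhoOrth x y) (p : ℝ) : 0 < rho (x + p • y) x := by
  refine lt_of_le_of_ne ?_ fun h0 => ?_
  · have h1 := hX.rho_le (x + p • y) (p • y)
    have h2 : ‖p • y‖ ≤ ‖x + p • y‖ := by
      rcases eq_or_ne p 0 with rfl | hp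
      · simp
      have := (hX _ _ h).bjOrth p⁻¹
      have e : x + p • y = p • (y + p⁻¹ • x) := by
        rw [smul_add, smul_smul, mul_inv_cancel₀ hp]; module
      rw [e, norm_smul, norm_smul]
      exact mul_le_mul_of_nonneg_left this (norm_nonneg p)
    have h3 := hX.rho_self (x + p • y)
    have h4 := hX.rho_add (x + p • y) x (p • y)
    nlinarith [norm_nonneg (x + p • y)]
  · have h1 : rho x (x + p • y) = 0 := hX _ _ h0.symm
    rw [hX.rho_add, hX.rho_self, hX.rho_smul, h] at h1
    simp [hx] at h1

theorem IsRhoSymmetric.rho_right_pos (hX : IsRhoSymmetric X) {x y : X} (hy : y ≠ 0)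
    (h : RhoOrth x y) {p : ℝ} (hp : 0 < p) : 0 < rho (x + p • y) y := by
  have h1 : RhoOrth (p • y) x := hX _ _ <| by
    rw [RhoOrth, hX.rho_smul, h, mul_zero]
  have h2 := hX.rho_left_pos (smul_ne_zero hp.ne' hy) h1 1
  rw [one_smul, add_comm, hX.rho_smul] at h2
  exact pos_of_mul_pos_right h2 hp.le

theorem IsRhoSymmetric.rhoSlope_pos (hX : IsRhoSymmetric X) {x y : X} (hx : x ≠ 0) (hy : y ≠ 0)
    (h : RhoOrth x y) {p : ℝ} (hp : 0 < p) : 0 < rhoSlope x y p :=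
  div_pos (hX.rho_right_pos hy h hp) (hX.rho_left_pos hx h p)

/-- With `w = x + p • y` and `w' = x + q • y`, the bounds on `rho w w'` and `rho w' w` multiply to
at most `rho w w * rho w' w'`; expanding leaves `q - p` times the cross-multiplied slope inequality.
-/
theorem IsRhoSymmetric.rhoSlope_mono (hX : IsRhoSymmetric X) {x y : X} (hx : x ≠ 0) (hy : y ≠ 0)
    (h : RhoOrth x y) {p q : ℝ} (hp : 0 < p) (hpq : p < q) :
    rhoSlope x y p ≤ rhoSlope x y q := by
  have hA := hX.rho_left_pos hx h p
  have hA' := hX.rho_left_pos hx h q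
  have hB := hX.rho_right_pos hy h hp
  have hB' := hX.rho_right_pos hy h (hp.trans hpq)
  have h1 := hX.rho_self (x + p • y)
  have h2 := hX.rho_self (x + q • y)
  have h3 := hX.rho_le (x + p • y) (x + q • y)
  have h4 := hX.rho_le (x + q • y) (x + p • y)
  rw [rhoSlope, rhoSlope, div_le_div_iff₀ hA hA']
  have e1 : ∀ u : X, rho u (x + p • y) = rho u x + p * rho u y := fun u => by
    rw [hX.rho_add, hX.rho_smul]
  have e2 : ∀ u : X, rho u (x + q • y) = rho u x + q * rho u y := fun u => by
    rw [hX.rho_add, hX.rho_smul]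
  rw [e1] at h1 h4
  rw [e2] at h2 h3
  generalize x + p • y = w at *
  generalize x + q • y = w' at *
  have hq := hp.trans hpq
  have h5 := mul_le_mul h3 h4 (by positivity) (by positivity)
  have h6 : ‖w‖ * ‖w'‖ * (‖w'‖ * ‖w‖) = ‖w‖ ^ 2 * ‖w'‖ ^ 2 := by ring
  rw [h6, ← h1, ← h2] at h5
  have h7 : (q - p) * (rho w y * rho w' x) ≤ (q - p) * (rho w' y * rho w x) := by linarith
  exact le_of_mul_le_mul_left h7 (by linarith)

/-- The slope map followed by a quarter turn is an involution. -/
theorem IsRhoSymmetric.rhoSlope_neg_inv (hX : IsRhoSymmetric X) {x y : X} (hx : x ≠ 0)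
    (h : RhoOrth x y) {p : ℝ} (hp : rhoSlope x y p ≠ 0) :
    p * rhoSlope x y (-(rhoSlope x y p)⁻¹) = -1 := by
  set r := -(rhoSlope x y p)⁻¹ with hr
  have hA := (hX.rho_left_pos hx h p).ne'
  have hA' := (hX.rho_left_pos hx h r).ne'
  -- `r` is chosen so that `x + r • y` spans the kernel of `rho (x + p • y)` in the plane.
  have h1 : rho (x + p • y) (x + r • y) = 0 := by
    have e : rho (x + p • y) y = rhoSlope x y p * rho (x + p • y) x := by
      rw [rhoSlope, div_mul_cancel₀ _ hA]
    rw [hX.rho_add, hX.rho_smul, e, hr]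
    field_simp
    ring
  have h2 : rho (x + r • y) (x + p • y) = 0 := hX _ _ h1
  rw [hX.rho_add, hX.rho_smul] at h2
  rw [rhoSlope, mul_div_assoc', div_eq_iff hA']
  linarith

theorem IsRhoSymmetric.rho_eq_zero_of_add (hX : IsRhoSymmetric X) {w z u : X} (h1 : rho w u = 0)
    (h2 : rho z u = 0) (p q : ℝ) : rho (p • w + q • z) u = 0 := by
  refine hX _ _ ?_
  have e1 : rho u w = 0 := hX _ _ h1
  have e2 : rho u z = 0 := hX _ _ h2
  rw [RhoOrth, hX.rho_add, hX.rho_smul, hX.rho_smul, e1, e2]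
  simp

/-- Adding a vector orthogonal to a plane does not change the slope in that plane. -/
theorem IsRhoSymmetric.rho_eq_rhoSlope_mul (hX : IsRhoSymmetric X) {x y z : X} (hx : x ≠ 0)
    (hxy : RhoOrth x y) (hxz : RhoOrth x z) (hyz : RhoOrth y z) (p a b : ℝ) :
    rho (a • (x + p • y) + b • z) y = rhoSlope x y p * rho (a • (x + p • y) + b • z) x := by
  have hA := (hX.rho_left_pos hx hxy p).ne'
  have hzx : rho z x = 0 := hX _ _ hxz
  have hzy : rho z y = 0 := hX _ _ hyz
  have h1 : rho (x + p • y) (y + (-rhoSlope x y p) • x) = 0 := by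
    rw [hX.rho_add, hX.rho_smul, rhoSlope]
    field_simp
    ring
  have h2 : rho z (y + (-rhoSlope x y p) • x) = 0 := by
    rw [hX.rho_add, hX.rho_smul, hzx, hzy]
    simp
  have h3 := hX.rho_eq_zero_of_add h1 h2 a b
  rw [hX.rho_add, hX.rho_smul] at h3
  linarith

theorem IsRhoSymmetric.rhoSlope_mul (hX : IsRhoSymmetric X) {x y z : X} (hx : x ≠ 0) (hy : y ≠ 0)
    (hxy : RhoOrth x y) (hxz : RhoOrth x z) (hyz : RhoOrth y z) (p q : ℝ) :
    rhoSlope x y p * rhoSlope y z q = rhoSlope x z (p * q) := by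
  have h1 := hX.rho_eq_rhoSlope_mul hx hxy hxz hyz p 1 (p * q)
  have h2 := hX.rho_eq_rhoSlope_mul hy hyz (hX _ _ hxy) (hX _ _ hxz) q p 1
  have h3 := hX.rho_eq_rhoSlope_mul hx hxz hxy (hX _ _ hyz) (p * q) 1 p
  -- One vector grouped in three ways, so its ratios are read off in each coordinate plane.
  have e1 : (1 : ℝ) • (x + p • y) + (p * q) • z = x + (1 : ℝ) • (p • y + (p * q) • z) := by module
  have e2 : p • (y + q • z) + (1 : ℝ) • x = x + (1 : ℝ) • (p • y + (p * q) • z) := by module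
  have e3 : (1 : ℝ) • (x + (p * q) • z) + p • y = x + (1 : ℝ) • (p • y + (p * q) • z) := by module
  rw [e1] at h1
  rw [e2] at h2
  rw [e3] at h3
  have hA : 0 < rho (x + (1 : ℝ) • (p • y + (p * q) • z)) x := by
    refine hX.rho_left_pos hx ?_ 1
    rw [RhoOrth, hX.rho_add, hX.rho_smul, hX.rho_smul, hxy, hxz]
    simp
  rw [h1, h3] at h2
  refine mul_right_cancel₀ hA.ne' ?_
  linarith

/-- A positive monotone function on the positive reals that is multiplicative up to a constant and
satisfies an involution property is linear. -/
theorem eq_mul_of_involutive {φ : ℝ → ℝ} {a : ℝ} (ha : 0 < a)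
    (hpos : ∀ p, 0 < p → 0 < φ p) (hmono : ∀ p q, 0 < p → p < q → φ p ≤ φ q)
    (hmul : ∀ p q, φ p * φ q = a * φ (p * q))
    (hinv : ∀ p, 0 < p → p * φ (-(φ p)⁻¹) = -1) {p : ℝ} (hp : 0 < p) : φ p = a * p := by
  have h1 : φ 1 = a := by
    have := hmul 1 1
    rw [mul_one] at this
    exact mul_right_cancel₀ (hpos 1 one_pos).ne' this
  -- The involution gives values at negative arguments; the unknown `φ (-1)` is eliminated by
  -- comparing `q` with `1`.
  have key : ∀ q, 0 < q → φ (φ q) = q * φ a := by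
    intro q hq
    have i1 := hinv q hq
    have i2 := hinv 1 one_pos
    rw [h1, one_mul] at i2
    have m1 := hmul (-(φ q)⁻¹) (φ q)
    have m2 := hmul (-a⁻¹) a
    have hne := (hpos q hq).ne'
    rw [show -(φ q)⁻¹ * φ q = -1 by field_simp] at m1
    rw [show -a⁻¹ * a = -1 by field_simp, i2] at m2
    rw [← m2] at m1
    have : q * φ (-(φ q)⁻¹) * φ (φ q) = q * (-1 * φ a) := by rw [← m1]; ring
    rw [i1] at this
    linarith
  have hscale : ∀ q, 0 < q → φ (φ q) * a = φ a * (a * (φ (φ q / a)) / a) := by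
    intro q _
    have := hmul a (φ q / a)
    rw [mul_div_cancel₀ _ ha.ne'] at this
    field_simp
    linarith
  -- Thus `q ↦ φ q / a` is a monotone involution of the positive reals, hence the identity.
  have hm : ∀ q, 0 < q → φ (φ q / a) = a * q := by
    intro q hq
    have h2 := hscale q hq
    rw [key q hq] at h2
    have hφa := (hpos a ha).ne'
    field_simp at h2
    linarith
  have hp2 := hm p hp
  have hq : 0 < φ p / a := div_pos (hpos p hp) ha
  rcases lt_trichotomy (φ p / a) p with h | h | h
  · have := hmono _ _ hq h
    rw [hp2] at this
    rw [div_lt_iff₀ ha] at h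
    linarith
  · rw [div_eq_iff ha.ne'] at h
    linarith
  · have := hmono _ _ hp h
    rw [hp2] at this
    rw [lt_div_iff₀ ha] at h
    linarith

theorem IsRhoSymmetric.rhoSlope_eq (hX : IsRhoSymmetric X) {x y z : X} (hx : x ≠ 0) (hy : y ≠ 0)
    (hz : z ≠ 0) (hxy : RhoOrth x y) (hxz : RhoOrth x z) (hyz : RhoOrth y z) {p : ℝ}
    (hp : 0 < p) : rhoSlope x y p = rhoSlope x y 1 * p := by
  have ha := hX.rhoSlope_pos hx hy hxy one_pos
  refine eq_mul_of_involutive ha (fun p hp => hX.rhoSlope_pos hx hy hxy hp)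
    (fun p q hp hq => hX.rhoSlope_mono hx hy hxy hp hq) (fun p q => ?_)
    (fun p hp => hX.rhoSlope_neg_inv hx hxy (hX.rhoSlope_pos hx hy hxy hp).ne') hp
  have hmul := hX.rhoSlope_mul hx hy hxy hxz hyz
  have hb := (hX.rhoSlope_pos hy hz hyz one_pos).ne'
  have h1 := hmul p q
  have h2 := hmul (p * q) 1
  have h3 := hmul 1 q
  have h4 := hmul q 1
  rw [mul_one] at h2 h4
  rw [one_mul] at h3
  refine mul_right_cancel₀ hb ?_
  calc rhoSlope x y p * rhoSlope x y q * rhoSlope y z 1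
      = rhoSlope x y 1 * (rhoSlope x y p * rhoSlope y z q) := by
        rw [mul_assoc, h4, ← h3]; ring
    _ = _ := by rw [h1, ← h2]; ring

/-! ### From linear slopes to Pythagoras and the parallelogram law. -/

theorem hasDerivWithinAt_norm_sq (x y : X) (p : ℝ) :
    HasDerivWithinAt (fun t : ℝ => ‖x + t • y‖ ^ 2) (2 * rhoPlus (x + p • y) y) (Ici p) p := by
  set w := x + p • y with hw
  have h0 : HasDerivWithinAt (fun t : ℝ => ‖w + t • y‖)
      (limUnder (𝓝[>] (0 : ℝ)) (fun t : ℝ => (‖w + t • y‖ - ‖w‖) / t)) (Ici 0) 0 := by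
    rw [← hasDerivWithinAt_Ioi_iff_Ici, hasDerivWithinAt_iff_tendsto_slope' (by simp),
      ← quotient_eq_slope]
    exact tendsto_rhoPlus w y
  have h1 : HasDerivWithinAt (fun t : ℝ => t - p) 1 (Ici p) p :=
    ((hasDerivAt_id p).sub_const p).hasDerivWithinAt
  have h0' : HasDerivWithinAt (fun t : ℝ => ‖w + t • y‖)
      (limUnder (𝓝[>] (0 : ℝ)) (fun t : ℝ => (‖w + t • y‖ - ‖w‖) / t)) (Ici 0) (p - p) := by
    rwa [sub_self]
  have h2 := (HasDerivWithinAt.comp (h := fun t : ℝ => t - p) p h0' h1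
    (fun t (ht : p ≤ t) => sub_nonneg.2 ht)).pow 2
  have e : ∀ t : ℝ, w + (t - p) • y = x + t • y := fun t => by rw [hw]; module
  refine (h2.congr_deriv ?_).congr_of_eventuallyEq (Eventually.of_forall fun t => ?_) ?_
  · simp only [Function.comp_apply, sub_self, zero_smul, add_zero, rhoPlus]
    norm_num
    ring
  · simp [e]
  · simp [hw]

theorem IsRhoSymmetric.norm_add_sq_eq_mul (hX : IsRhoSymmetric X) {x y z : X} (hx : x ≠ 0)
    (hy : y ≠ 0) (hz : z ≠ 0) (hxy : RhoOrth x y) (hxz : RhoOrth x z) (hyz : RhoOrth y z) :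
    ‖x + y‖ ^ 2 = ‖x‖ ^ 2 * (1 + rhoSlope x y 1) := by
  set c := rhoSlope x y 1 with hc
  have hcpos : 0 < c := hX.rhoSlope_pos hx hy hxy one_pos
  have hpos : ∀ t : ℝ, 0 < 1 + c * t ^ 2 := fun t => by positivity
  have hB : ∀ p : ℝ, 0 ≤ p →
      rho (x + p • y) y * (1 + c * p ^ 2) = c * p * ‖x + p • y‖ ^ 2 := by
    intro p hp
    have hs : rho (x + p • y) y = c * p * rho (x + p • y) x := by
      rcases hp.eq_or_lt with rfl | hp
      · simpa [RhoOrth] using hxy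
      · have := hX.rhoSlope_eq hx hy hz hxy hxz hyz hp
        rw [rhoSlope, div_eq_iff (hX.rho_left_pos hx hxy p).ne'] at this
        exact this
    have h1 := hX.rho_self (x + p • y)
    have h2 := hX.rho_add (x + p • y) x (p • y)
    rw [h1, hX.rho_smul] at h2
    rw [h2]
    linear_combination hs
  -- `hB` is the differential equation for `‖x + t • y‖ ^ 2` whose solutions are multiples of `1 + c
  -- * t ^ 2`.
  have hconst := constant_of_has_deriv_right_zero (a := (0 : ℝ)) (b := 1)
    (f := fun t : ℝ => ‖x + t • y‖ ^ 2 / (1 + c * t ^ 2))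
    (Continuous.continuousOn (by
      refine Continuous.div ?_ ?_ fun t => (hpos t).ne' <;> fun_prop))
    (fun p hp => by
      have d1 := hasDerivWithinAt_norm_sq x y p
      have d2 : HasDerivWithinAt (fun t : ℝ => 1 + c * t ^ 2) (c * (2 * p)) (Ici p) p := by
        simpa using (((hasDerivAt_pow 2 p).const_mul c).const_add 1).hasDerivWithinAt
      refine (d1.div d2 (hpos p).ne').congr_deriv ?_
      rw [← hX.rho_eq_rhoPlus, div_eq_zero_iff]
      left
      linear_combination 2 * hB p hp.1)
  have h := hconst 1 (by simp)
  simp only [one_smul, one_pow, mul_one, zero_smul, add_zero] at h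
  rw [div_eq_iff (by positivity)] at h
  rw [h]
  norm_num

/-- Exchanging `x` and `y` inverts the slope at `1`; comparing both formulas for `‖x + y‖ ^ 2`
identifies it as `‖y‖ ^ 2 / ‖x‖ ^ 2`. -/
theorem IsRhoSymmetric.norm_add_sq (hX : IsRhoSymmetric X) {x y z : X}
    (hz : z ≠ 0) (hxy : RhoOrth x y) (hxz : RhoOrth x z) (hyz : RhoOrth y z) :
    ‖x + y‖ ^ 2 = ‖x‖ ^ 2 + ‖y‖ ^ 2 := by
  rcases eq_or_ne x 0 with rfl | hx
  · simp
  rcases eq_or_ne y 0 with rfl | hy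
  · simp
  have h1 := hX.norm_add_sq_eq_mul hx hy hz hxy hxz hyz
  have h2 := hX.norm_add_sq_eq_mul hy hx hz (hX _ _ hxy) hyz hxz
  have hc := hX.rhoSlope_pos hx hy hxy one_pos
  have e : rhoSlope y x 1 = (rhoSlope x y 1)⁻¹ := by
    simp only [rhoSlope, one_smul, inv_div, add_comm]
  rw [e, add_comm y x] at h2
  generalize rhoSlope x y 1 = c at *
  have h3 : (1 + c) * ‖y‖ ^ 2 = (1 + c) * (c * ‖x‖ ^ 2) := by
    rw [h1] at h2
    field_simp at h2
    linarith
  have h4 := mul_left_cancel₀ (by positivity) h3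
  rw [h1, h4]
  ring

theorem IsRhoSymmetric.exists_orth (hX : IsRhoSymmetric X) (hr : 3 ≤ Module.rank ℝ X) (x y : X) :
    ∃ z : X, z ≠ 0 ∧ RhoOrth x z ∧ RhoOrth y z := by
  by_contra! hcon
  let L : X →ₗ[ℝ] ℝ × ℝ := (hX.rhoLin x).prod (hX.rhoLin y)
  have hinj : Function.Injective L := by
    rw [injective_iff_map_eq_zero]
    intro z hz
    by_contra hz0
    exact hcon z hz0 (congrArg Prod.fst hz) (congrArg Prod.snd hz)
  have h := LinearMap.lift_rank_le_of_injective L hinj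
  have h2 : Module.rank ℝ (ℝ × ℝ) = 2 := by
    rw [rank_prod', Module.rank_self]; norm_num
  rw [h2] at h
  have h3 := Cardinal.lift_le.2 hr
  have h4 := h3.trans h
  simp only [Cardinal.lift_ofNat] at h4
  exact absurd h4 (by norm_num)

theorem IsRhoSymmetric.parallelogram (hX : IsRhoSymmetric X) (hr : 3 ≤ Module.rank ℝ X)
    (u v : X) : ‖u + v‖ * ‖u + v‖ + ‖u - v‖ * ‖u - v‖ = 2 * (‖u‖ * ‖u‖ + ‖v‖ * ‖v‖) := by
  rcases eq_or_ne u 0 with rfl | hu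
  · simp; ring
  have hu2 : ‖u‖ ^ 2 ≠ 0 := pow_ne_zero 2 (norm_ne_zero_iff.2 hu)
  obtain ⟨a, ha⟩ : ∃ a : ℝ, rho u (v + a • u) = 0 :=
    ⟨-(rho u v / ‖u‖ ^ 2), by rw [rho_add_smul_self]; field_simp; ring⟩
  obtain ⟨w, rfl⟩ : ∃ w, v = w + (-a) • u := ⟨v + a • u, by module⟩
  have hw : rho u w = 0 := by
    rw [← ha]; congr 1; module
  obtain ⟨z, hz, huz, hwz⟩ := hX.exists_orth hr u w
  -- The squared norm is a quadratic form on the plane of `u` and `v`.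
  have key : ∀ s t : ℝ, ‖s • u + t • w‖ ^ 2 = s ^ 2 * ‖u‖ ^ 2 + t ^ 2 * ‖w‖ ^ 2 := by
    intro s t
    have hzu : rho z u = 0 := hX _ _ huz
    have hzw : rho z w = 0 := hX _ _ hwz
    have h1 : RhoOrth (s • u) w := hX _ _ <| by
      have : rho w u = 0 := hX _ _ hw
      rw [RhoOrth, hX.rho_smul, this, mul_zero]
    rw [hX.norm_add_sq (x := s • u) (y := t • w) hz
      (by rw [RhoOrth, hX.rho_smul, h1, mul_zero])
      (hX _ _ (by rw [RhoOrth, hX.rho_smul, hzu, mul_zero]))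
      (hX _ _ (by rw [RhoOrth, hX.rho_smul, hzw, mul_zero])), norm_smul, norm_smul,
      mul_pow, mul_pow, Real.norm_eq_abs, Real.norm_eq_abs, sq_abs, sq_abs]
  have e1 : u + (w + (-a) • u) = (1 - a) • u + (1 : ℝ) • w := by module
  have e2 : u - (w + (-a) • u) = (1 + a) • u + (-1 : ℝ) • w := by module
  have e3 : w + (-a) • u = (-a) • u + (1 : ℝ) • w := by module
  rw [e1, e2, e3]
  simp only [← sq, key]
  ring

theorem IsRhoSymmetric.normFromInner (hX : IsRhoSymmetric X) (hr : 3 ≤ Module.rank ℝ X) :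
    NormFromInner X := by
  let _ : InnerProductSpace ℝ X := InnerProductSpace.ofNorm ℝ (hX.parallelogram hr)
  exact ⟨InnerProductSpace.toCore, fun x => norm_eq_sqrt_re_inner (𝕜 := ℝ) x⟩

/-! ### The converse: inner product norms. -/

theorem rho_eq_inner (c : InnerProductSpace.Core ℝ X) (hc : ∀ x : X, ‖x‖ = √(c.inner x x))
    (x y : X) : rho x y = c.inner x y := by
  have hsymm : ∀ u v : X, c.inner u v = c.inner v u := fun u v => by
    simpa using c.conj_inner_symm v u
  have hsq : ∀ u : X, ‖u‖ ^ 2 = c.inner u u := fun u => by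
    rw [hc u, Real.sq_sqrt]
    simpa using c.re_inner_nonneg u
  have hsmul : ∀ (u v : X) (r : ℝ), c.inner (r • u) v = r * c.inner u v := fun u v r => by
    simpa using c.smul_left u v r
  rcases eq_or_ne x 0 with rfl | hx
  · have := hsmul 0 y 0
    rw [zero_smul, zero_mul] at this
    rw [rho_zero_left, this]
  have hexp : ∀ t : ℝ, ‖x + t • y‖ ^ 2 = ‖x‖ ^ 2 + t * (2 * c.inner x y) + t ^ 2 * ‖y‖ ^ 2 := by
    intro t
    rw [hsq, hsq, hsq, c.add_left, hsymm x (x + t • y), hsymm (t • y), c.add_left, c.add_left,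
      hsmul, hsmul, hsymm x (t • y), hsmul, hsymm y (t • y), hsmul, hsymm y x]
    ring
  have hd : HasDerivAt (fun t : ℝ => ‖x + t • y‖ ^ 2) (2 * c.inner x y) 0 := by
    simp only [hexp]
    have := (((hasDerivAt_id (0 : ℝ)).mul_const (2 * c.inner x y)).const_add (‖x‖ ^ 2)).add
      ((hasDerivAt_pow 2 (0 : ℝ)).mul_const (‖y‖ ^ 2))
    refine HasDerivAt.congr_deriv this ?_
    simp
  have hx0 : ‖x‖ ≠ 0 := norm_ne_zero_iff.2 hx
  have hs := hd.sqrt (by simpa using hx)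
  simp only [Real.sqrt_sq (norm_nonneg _), zero_smul, add_zero] at hs
  rw [rho_eq_of_hasDerivAt hs]
  field_simp

theorem NormFromInner.isRhoSymmetric (h : NormFromInner X) : IsRhoSymmetric X := by
  obtain ⟨c, hc⟩ := h
  intro x y hxy
  rw [RhoOrth, rho_eq_inner c hc] at hxy ⊢
  rw [← c.conj_inner_symm, hxy, map_zero]

end Symmetric

end NormDeriv

theorem mainTheorem1 (X : Type*) [NormedAddCommGroup X] [NormedSpace ℝ X] :
    (Module.rank ℝ X = 2 → NormDeriv.IsRhoSymmetric X → NormDeriv.IsRadonPlane X) ∧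
    (3 ≤ Module.rank ℝ X → (NormDeriv.IsRhoSymmetric X ↔ NormDeriv.NormFromInner X)) :=
  ⟨fun hr hX => ⟨hr, fun _ _ h => hX.bjOrth_symm h⟩,
    fun hr => ⟨fun hX => hX.normFromInner hr, fun h => h.isRhoSymmetric⟩⟩
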